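/- Let $0<q<1$, and write $(x;p)_n=\prod_{k=0}^{n-1}(1-xp^k)$, $(x;p)_\infty=\prod_{k=0}^{\infty}(1-xp^k)$ and $\psi(q)=\sum_{n=0}^\infty q^{n(n+1)/2}$. Then for every complex number $a$ with $|a|<1$, $$\frac{(q^2;q^2)_\infty^2\,(aq;q^2)_\infty}{(a;q^2)_\infty^2\,(q;q^2)_\infty}=\sum_{n=0}^\infty\sum_{j=-n}^{n}(1+q^{2n+1})\,q^{2n^2+n-2j^2-j}\,\frac{(q^2/a;q^2)_n\,a^n}{(a;q^2)_{n+1}},$$ where for $a=0$ the factor $(q^2/a;q^2)_n\,a^n$ is understood as its limit $(-1)^nq^{n^2+n}$ as $a\to0$, so that the identity for $a=0$ reads $$\frac{(q^2;q^2)_\infty^2}{(q;q^2)_\infty}=\sum_{n=0}^\infty\sum_{j=-n}^{n}(-1)^n(1+q^{2n+1})\,q^{3n^2+2n-2j^2-j}.$$ The case $a=q$ gives $$\psi(q)^3=\sum_{n=0}^\infty\sum_{j=-n}^{n}\frac{1+q^{2n+1}}{1-q^{2n+1}}\,q^{2n^2+2n-2j^2-j}.$$ Consequently every nonnegative integer is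 the sum of three triangular numbers: for every integer $N\ge0$ there are integers $x,y,z\ge0$ with $N=\frac{x(x+1)}2+\frac{y(y+1)}2+\frac{z(z+1)}2$. All the series over $n$ converge absolutely. -/

import Mathlib

/-- The `q`-shifted factorial `(a; q)_n = ∏_{k=0}^{n-1} (1 - a q^k)`. -/
noncomputable def qPoch (a q : ℂ) (n : ℕ) : ℂ :=
  ∏ k ∈ Finset.range n, (1 - a * q ^ k)

/-- The infinite `q`-shifted factorial `(a; q)_∞ = ∏_{k=0}^∞ (1 - a q^k)`. -/
noncomputable def qPochInf (a q : ℂ) : ℂ :=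
  ∏' k : ℕ, (1 - a * q ^ k)

/-- The infinite product defining `(a; q)_∞` converges for `|q| < 1`. -/
theorem multipliable_qPochInf (a q : ℂ) (hq : ‖q‖ < 1) :
    Multipliable (fun k : ℕ => 1 - a * q ^ k) := by
  have h : Summable (fun k : ℕ => ‖-(a * q ^ k)‖) := by
    simp only [norm_neg, norm_mul, norm_pow]
    exact (summable_geometric_of_lt_one (norm_nonneg q) hq).mul_left ‖a‖
  simpa [sub_eq_add_neg] using multipliable_one_add_of_summable h

/-- Ramanujan's theta function `ψ(q) = ∑_{n=0}^∞ q^{n(n+1)/2}`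
(the division of natural numbers is exact). -/
noncomputable def ramanujanPsi (q : ℝ) : ℝ :=
  ∑' n : ℕ, q ^ (n * (n + 1) / 2)

/-- The series defining `ψ(q)` converges for `0 < q < 1`. -/
theorem summable_ramanujanPsi (q : ℝ) (h0 : 0 < q) (h1 : q < 1) :
    Summable (fun n : ℕ => q ^ (n * (n + 1) / 2)) := by
  refine Summable.of_nonneg_of_le (fun n => by positivity) (fun n => ?_)
    (summable_geometric_of_lt_one h0.le h1)
  refine pow_le_pow_of_le_one h0.le h1.le ?_
  rcases Nat.eq_zero_or_pos n with h | h
  · simp [h]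
  · rw [Nat.le_div_iff_mul_le (by norm_num)]
    exact Nat.mul_le_mul_left n (by omega)

/-! For fixed `q` both sides of the expansion are analytic in `a` on the unit disc, once `(q²/a;
q²)_n aⁿ` is read as the polynomial `shiftedProd`, which also covers `a = 0`. By the identity
theorem it suffices that they agree at the points `a = q^(2m+2)`, which accumulate at `0`. There the
series terminates and the claim is the Bailey pair identity `sum_baileyPair`, proved by a recurrence
in `m` whose partial sums have a closed form.

At `a = q` the product becomes the cube of Gauss' product for `ψ`, obtained as a limit of Shanks'
finite identity. The resulting series for `ψ³` is a sum of monomials with coefficient `+1`, and its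
`n = 0` block `(1+q)/(1-q)` already contains every power of `q`. Comparing coefficients with `ψ³`,
the generating function of triples of triangular numbers, shows that every `N` is represented. -/

open Filter Topology

/-! ### The inner sums and finite `q`-factorials -/

/-- The inner sum `∑_{j=-n}^n q^{2n²+n-2j²-j}`. -/
noncomputable def bilateralSum (q : ℂ) (n : ℕ) : ℂ :=
  ∑ j ∈ Finset.Icc (-(n : ℤ)) (n : ℤ), q ^ (2 * (n : ℤ) ^ 2 + (n : ℤ) - 2 * j ^ 2 - j)

theorem bilateralSum_zero (q : ℂ) : bilateralSum q 0 = 1 := by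
  simp [bilateralSum]

/-- The exponent of each old term grows by `4n+3`; the new indices `j = -(n+1)` and `j = n+1`
contribute `q^(2n+2)` and `1`. -/
theorem bilateralSum_succ {q : ℂ} (hq : q ≠ 0) (n : ℕ) :
    bilateralSum q (n + 1) = q ^ (4 * n + 3) * bilateralSum q n + q ^ (2 * n + 2) + 1 := by
  have hIcc : Finset.Icc (-((n + 1 : ℕ) : ℤ)) ((n + 1 : ℕ) : ℤ) =
      insert ((n + 1 : ℕ) : ℤ) (insert (-((n + 1 : ℕ) : ℤ)) (Finset.Icc (-(n : ℤ)) (n : ℤ))) := by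
    ext j
    simp only [Finset.mem_Icc, Finset.mem_insert]
    push_cast
    omega
  rw [bilateralSum, hIcc, Finset.sum_insert, Finset.sum_insert, bilateralSum, Finset.mul_sum]
  · have h1 : ∀ j : ℤ, q ^ (2 * ((n + 1 : ℕ) : ℤ) ^ 2 + ((n + 1 : ℕ) : ℤ) - 2 * j ^ 2 - j) =
        q ^ (4 * n + 3) * q ^ (2 * (n : ℤ) ^ 2 + (n : ℤ) - 2 * j ^ 2 - j) := by
      intro j
      rw [← zpow_natCast, ← zpow_add₀ hq]
      congr 1
      push_cast
      ring
    have h2 : q ^ (2 * ((n + 1 : ℕ) : ℤ) ^ 2 + ((n + 1 : ℕ) : ℤ) - 2 * (-((n + 1 : ℕ) : ℤ)) ^ 2 -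
        (-((n + 1 : ℕ) : ℤ))) = q ^ (2 * n + 2) := by
      rw [← zpow_natCast]
      congr 1
      push_cast
      ring
    have h3 : q ^ (2 * ((n + 1 : ℕ) : ℤ) ^ 2 + ((n + 1 : ℕ) : ℤ) - 2 * ((n + 1 : ℕ) : ℤ) ^ 2 -
        ((n + 1 : ℕ) : ℤ)) = 1 := by
      rw [← zpow_zero q]
      congr 1
      ring
    rw [h2, h3, Finset.sum_congr rfl fun j _ => h1 j]
    ring
  · simp
  · simp only [Finset.mem_insert, Finset.mem_Icc]
    push_cast
    omega

theorem norm_bilateralSum_le {q : ℂ} (hq : q ≠ 0) (hq1 : ‖q‖ < 1) (n : ℕ) :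
    ‖bilateralSum q n‖ ≤ 2 * n + 1 := by
  induction n with
  | zero => simp [bilateralSum_zero]
  | succ n ih =>
    rw [bilateralSum_succ hq]
    have h1 : ‖q‖ ^ (4 * n + 3) ≤ 1 := pow_le_one₀ (norm_nonneg q) hq1.le
    have h2 : ‖q‖ ^ (2 * n + 2) ≤ 1 := pow_le_one₀ (norm_nonneg q) hq1.le
    calc ‖q ^ (4 * n + 3) * bilateralSum q n + q ^ (2 * n + 2) + 1‖
        ≤ ‖q‖ ^ (4 * n + 3) * ‖bilateralSum q n‖ + ‖q‖ ^ (2 * n + 2) + 1 := by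
          refine (norm_add_le _ _).trans ?_
          rw [norm_one]
          gcongr
          refine (norm_add_le _ _).trans ?_
          rw [norm_mul, norm_pow, norm_pow]
      _ ≤ 1 * (2 * n + 1) + 1 + 1 := by gcongr
      _ = 2 * ((n + 1 : ℕ) : ℝ) + 1 := by push_cast; ring

theorem qPoch_zero (a q : ℂ) : qPoch a q 0 = 1 := by simp [qPoch]

theorem qPoch_succ (a q : ℂ) (n : ℕ) : qPoch a q (n + 1) = qPoch a q n * (1 - a * q ^ n) :=
  Finset.prod_range_succ _ _

theorem one_sub_pow_ne_zero {q : ℂ} (hq1 : ‖q‖ < 1) (n : ℕ) : 1 - q ^ (n + 1) ≠ 0 := by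
  intro h
  have h1 : ‖q ^ (n + 1)‖ < 1 := by
    rw [norm_pow]
    exact pow_lt_one₀ (norm_nonneg q) hq1 (Nat.succ_ne_zero n)
  rw [← sub_eq_zero.mp h, norm_one] at h1
  exact lt_irrefl _ h1

theorem one_sub_mul_pow_ne_zero {a q : ℂ} (ha : ‖a‖ < 1) (hq1 : ‖q‖ < 1) (n : ℕ) :
    1 - a * q ^ n ≠ 0 := by
  intro h
  have h1 : ‖a * q ^ n‖ < 1 := by
    rw [norm_mul, norm_pow]
    exact mul_lt_one_of_nonneg_of_lt_one_left (norm_nonneg a) ha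
      (pow_le_one₀ (norm_nonneg q) hq1.le)
  rw [← sub_eq_zero.mp h, norm_one] at h1
  exact lt_irrefl _ h1

theorem qPoch_ne_zero {a q : ℂ} (ha : ‖a‖ < 1) (hq1 : ‖q‖ < 1) (n : ℕ) : qPoch a q n ≠ 0 :=
  Finset.prod_ne_zero_iff.mpr fun k _ => one_sub_mul_pow_ne_zero ha hq1 k

theorem norm_sq_lt_one {q : ℂ} (hq1 : ‖q‖ < 1) : ‖q ^ 2‖ < 1 := by
  rw [norm_pow]
  exact pow_lt_one₀ (norm_nonneg q) hq1 two_ne_zero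

theorem qPoch_sq_succ (q : ℂ) (n : ℕ) :
    qPoch (q ^ 2) (q ^ 2) (n + 1) = qPoch (q ^ 2) (q ^ 2) n * (1 - q ^ (2 * n + 2)) := by
  rw [qPoch_succ]
  ring

/-! ### The Bailey pair identity -/

/-- Partial sums of the recurrence for the Bailey pair, in closed form. -/
theorem sum_range_baileyPair_sub {q : ℂ} (hq : q ≠ 0) (hq1 : ‖q‖ < 1) (N k : ℕ) :
    ∑ n ∈ Finset.range (N + 1), (-1) ^ n * (1 + q ^ (2 * n + 1)) * q ^ (n ^ 2 + n) *
        bilateralSum q n *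
        (1 / (qPoch (q ^ 2) (q ^ 2) (N + k - n) * qPoch (q ^ 2) (q ^ 2) (N + k + n + 1)) -
          (1 - q ^ (2 * (N + k) + 3)) /
            (qPoch (q ^ 2) (q ^ 2) (N + k + 1 - n) * qPoch (q ^ 2) (q ^ 2) (N + k + n + 2))) =
      q ^ (2 * (N + k) + 2) *
        ((-1) ^ (N + 1) * q ^ (N ^ 2 + 5 * N + 3) * bilateralSum q N /
            (qPoch (q ^ 2) (q ^ 2) k * qPoch (q ^ 2) (q ^ 2) (2 * N + k + 2)) -
          (-1) ^ N * q ^ (N ^ 2 + N) / ((1 - q ^ (2 * (N + k) + 2)) *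
            (qPoch (q ^ 2) (q ^ 2) k * qPoch (q ^ 2) (q ^ 2) (2 * N + k + 1)))) := by
  have hp := norm_sq_lt_one hq1
  have hQ : ∀ n, qPoch (q ^ 2) (q ^ 2) n ≠ 0 := qPoch_ne_zero hp hp
  have h1 : ∀ n, 1 - q ^ (n + 1) ≠ 0 := one_sub_pow_ne_zero hq1
  -- The level is `m = N + k`. Extending the sum by one term at fixed `m` lowers `k` by one, so the
  -- hypothesis is used at `k + 1`.
  induction N generalizing k with
  | zero =>
    simp only [zero_add, Finset.sum_range_one, bilateralSum_zero, Nat.sub_zero, add_zero, mul_zero]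
    have e1 := qPoch_sq_succ q k
    have e2 := qPoch_sq_succ q (k + 1)
    have a0 := hQ k
    have a1 := h1 (2 * k + 1)
    have a2 := h1 (2 * k + 3)
    rw [show k + 2 = k + 1 + 1 by rfl, e2, e1]
    simp only [show 2 * (k + 1) + 2 = 2 * k + 3 + 1 by ring,
      show 2 * k + 2 = 2 * k + 1 + 1 by ring]
    field_simp
    ring
  | succ N ih =>
    rw [Finset.sum_range_succ]
    have ih' := ih (k + 1)
    simp only [show N + 1 + k = N + (k + 1) by ring]
    rw [ih']
    have e1 := qPoch_sq_succ q k
    have e3 := qPoch_sq_succ q (2 * N + k + 2)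
    have e4 := qPoch_sq_succ q (2 * N + k + 3)
    have a0 := hQ k
    have a3 := hQ (2 * N + k + 2)
    have a1 := h1 (2 * k + 1)
    have a2 := h1 (2 * k + 3)
    have a4 := h1 (4 * N + 2 * k + 5)
    have a5 := h1 (4 * N + 2 * k + 7)
    have a6 := h1 (2 * N + 2 * k + 3)
    simp only [show N + (k + 1) - (N + 1) = k by omega, show N + (k + 1) + 1 - (N + 1) = k + 1 by omega,
      show N + (k + 1) + (N + 1) + 1 = 2 * N + k + 3 by omega,
      show N + (k + 1) + (N + 1) + 2 = 2 * N + k + 3 + 1 by omega,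
      show 2 * N + (k + 1) + 2 = 2 * N + k + 2 + 1 by omega,
      show 2 * N + (k + 1) + 1 = 2 * N + k + 2 by omega,
      show 2 * (N + 1) + k + 2 = 2 * N + k + 3 + 1 by omega,
      show 2 * (N + 1) + k + 1 = 2 * N + k + 2 + 1 by omega, e4, e3, e1, bilateralSum_succ hq]
    simp only [show 2 * N + k + 3 = 2 * N + k + 2 + 1 by omega,
      show 2 * (2 * N + k + 2) + 2 = 4 * N + 2 * k + 5 + 1 by ring,
      show 2 * (2 * N + k + 2 + 1) + 2 = 4 * N + 2 * k + 7 + 1 by ring,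
      show 2 * (N + (k + 1)) + 2 = 2 * N + 2 * k + 3 + 1 by ring,
      show 2 * k + 2 = 2 * k + 1 + 1 by ring]
    -- What remains is a rational identity in which the inner sum and the two factorials are free
    -- symbols.
    generalize bilateralSum q N = S at *
    generalize qPoch (q ^ 2) (q ^ 2) k = A at *
    generalize qPoch (q ^ 2) (q ^ 2) (2 * N + k + 2) = B at *
    field_simp
    ring

/-- At `k = 0` the closed form of the partial sum is exactly the extra term `n = m + 1` on the
right. -/
theorem sum_baileyPair_succ {q : ℂ} (hq : q ≠ 0) (hq1 : ‖q‖ < 1) (m : ℕ) :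
    ∑ n ∈ Finset.range (m + 1), (-1) ^ n * (1 + q ^ (2 * n + 1)) * q ^ (n ^ 2 + n) *
        bilateralSum q n /
        (qPoch (q ^ 2) (q ^ 2) (m - n) * qPoch (q ^ 2) (q ^ 2) (m + n + 1)) =
      (1 - q ^ (2 * m + 3)) *
        ∑ n ∈ Finset.range (m + 1 + 1), (-1) ^ n * (1 + q ^ (2 * n + 1)) * q ^ (n ^ 2 + n) *
          bilateralSum q n /
          (qPoch (q ^ 2) (q ^ 2) (m + 1 - n) * qPoch (q ^ 2) (q ^ 2) (m + 1 + n + 1)) := by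
  have hp := norm_sq_lt_one hq1
  have h := sum_range_baileyPair_sub hq hq1 m 0
  rw [Finset.sum_range_succ _ (m + 1), mul_add, Finset.mul_sum, ← sub_eq_iff_eq_add',
    ← Finset.sum_sub_distrib]
  have h' : ∀ n ∈ Finset.range (m + 1), (-1) ^ n * (1 + q ^ (2 * n + 1)) * q ^ (n ^ 2 + n) *
        bilateralSum q n /
        (qPoch (q ^ 2) (q ^ 2) (m - n) * qPoch (q ^ 2) (q ^ 2) (m + n + 1)) -
      (1 - q ^ (2 * m + 3)) * ((-1) ^ n * (1 + q ^ (2 * n + 1)) * q ^ (n ^ 2 + n) *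
          bilateralSum q n /
          (qPoch (q ^ 2) (q ^ 2) (m + 1 - n) * qPoch (q ^ 2) (q ^ 2) (m + 1 + n + 1))) =
      (-1) ^ n * (1 + q ^ (2 * n + 1)) * q ^ (n ^ 2 + n) *
        bilateralSum q n *
        (1 / (qPoch (q ^ 2) (q ^ 2) (m + 0 - n) * qPoch (q ^ 2) (q ^ 2) (m + 0 + n + 1)) -
          (1 - q ^ (2 * (m + 0) + 3)) /
            (qPoch (q ^ 2) (q ^ 2) (m + 0 + 1 - n) * qPoch (q ^ 2) (q ^ 2) (m + 0 + n + 2))) := by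
    intro n _
    rw [show m + 1 + n + 1 = m + n + 2 by ring]
    simp only [add_zero]
    ring
  rw [Finset.sum_congr rfl h', h]
  have a0 : qPoch (q ^ 2) (q ^ 2) (2 * m + 1) ≠ 0 := qPoch_ne_zero hp hp _
  have a1 := one_sub_pow_ne_zero hq1 (4 * m + 3)
  have a2 := one_sub_pow_ne_zero hq1 (4 * m + 5)
  have a3 := one_sub_pow_ne_zero hq1 (2 * m + 1)
  have e1 := qPoch_sq_succ q (2 * m + 1)
  have e2 := qPoch_sq_succ q (2 * m + 2)
  simp only [add_zero, qPoch_zero, Nat.sub_self, bilateralSum_succ hq,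
    show m + 1 + (m + 1) + 1 = 2 * m + 2 + 1 by ring, e2, show 2 * m + 2 = 2 * m + 1 + 1 by ring, e1,
    show 2 * (2 * m + 1) + 2 = 4 * m + 3 + 1 by ring,
    show 2 * (2 * m + 1 + 1) + 2 = 4 * m + 5 + 1 by ring]
  generalize bilateralSum q m = S at *
  generalize qPoch (q ^ 2) (q ^ 2) (2 * m + 1) = B at *
  field_simp
  ring

theorem sum_baileyPair {q : ℂ} (hq : q ≠ 0) (hq1 : ‖q‖ < 1) (m : ℕ) :
    ∑ n ∈ Finset.range (m + 1), (-1) ^ n * (1 + q ^ (2 * n + 1)) * q ^ (n ^ 2 + n) *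
        bilateralSum q n /
        (qPoch (q ^ 2) (q ^ 2) (m - n) * qPoch (q ^ 2) (q ^ 2) (m + n + 1)) =
      1 / qPoch q (q ^ 2) (m + 1) := by
  induction m with
  | zero =>
    have h1 : 1 - q ≠ 0 := by simpa using one_sub_pow_ne_zero hq1 0
    have h2 : 1 - q ^ 2 ≠ 0 := one_sub_pow_ne_zero hq1 1
    simp [qPoch, bilateralSum_zero]
    field_simp
    ring
  | succ m ih =>
    rw [sum_baileyPair_succ hq hq1] at ih
    have h1 := one_sub_pow_ne_zero hq1 (2 * m + 2)
    have h2 : qPoch q (q ^ 2) (m + 1) ≠ 0 := qPoch_ne_zero hq1 (norm_sq_lt_one hq1) _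
    rw [qPoch_succ q (q ^ 2) (m + 1), show q * (q ^ 2) ^ (m + 1) = q ^ (2 * m + 2 + 1) by ring]
    refine mul_left_cancel₀ h1 ?_
    rw [ih]
    field_simp

/-! ### Analyticity and majorants in the variable `a` -/

theorem summable_norm_mul_pow (a : ℂ) {q : ℂ} (hq1 : ‖q‖ < 1) :
    Summable (fun k : ℕ => ‖-(a * q ^ k)‖) := by
  simp only [norm_neg, norm_mul, norm_pow]
  exact (summable_geometric_of_lt_one (norm_nonneg q) hq1).mul_left ‖a‖

theorem qPochInf_ne_zero {a q : ℂ} (ha : ‖a‖ < 1) (hq1 : ‖q‖ < 1) : qPochInf a q ≠ 0 := by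
  simp only [qPochInf, sub_eq_add_neg]
  refine tprod_one_add_ne_zero_of_summable (fun k => ?_) (summable_norm_mul_pow a hq1)
  simpa only [sub_eq_add_neg] using one_sub_mul_pow_ne_zero ha hq1 k

theorem qPoch_mul_qPochInf (a : ℂ) {q : ℂ} (hq1 : ‖q‖ < 1) (n : ℕ) :
    qPoch a q n * qPochInf (a * q ^ n) q = qPochInf a q := by
  have h' : (fun k : ℕ => 1 - a * q ^ n * q ^ k) = fun k => 1 - a * q ^ (k + n) := by
    funext k
    rw [pow_add, mul_assoc, mul_comm (q ^ n)]
  have h := multipliable_qPochInf (a * q ^ n) q hq1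
  rw [h'] at h
  have h2 := Multipliable.prod_mul_tprod_nat_mul' (f := fun k : ℕ => 1 - a * q ^ k) h
  unfold qPoch qPochInf
  rw [h']
  exact h2

theorem differentiableOn_qPochInf {q : ℂ} (hq1 : ‖q‖ < 1) (r : ℝ) :
    DifferentiableOn ℂ (fun a => qPochInf a q) (Metric.ball 0 r) := by
  have hs : Summable (fun k : ℕ => r * ‖q‖ ^ k) :=
    (summable_geometric_of_lt_one (norm_nonneg q) hq1).mul_left r
  have h := Summable.hasProdLocallyUniformlyOn_nat_one_add
    (f := fun (k : ℕ) (a : ℂ) => -(a * q ^ k)) (K := Metric.ball 0 r) Metric.isOpen_ball hs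
    (.of_forall fun k a ha => by
      rw [norm_neg, norm_mul, norm_pow]
      have : ‖a‖ ≤ r := (mem_ball_zero_iff.mp ha).le
      gcongr) (fun k => by fun_prop)
  simp only [qPochInf, sub_eq_add_neg]
  exact h.differentiableOn (.of_forall fun s => by
    simpa [Finset.prod_fn] using DifferentiableOn.finsetProd (fun _ _ => by fun_prop))
    Metric.isOpen_ball

/-- The polynomial `(q²/a; q²)_n aⁿ = ∏_{k=1}^n (a - q^{2k})` in `a`. -/
noncomputable def shiftedProd (q a : ℂ) (n : ℕ) : ℂ :=
  ∏ k ∈ Finset.range n, (a - q ^ (2 * k + 2))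

/-- The `n`-th term of the main expansion. -/
noncomputable def expansionTerm (q a : ℂ) (n : ℕ) : ℂ :=
  (1 + q ^ (2 * n + 1)) * bilateralSum q n * (shiftedProd q a n / qPoch a (q ^ 2) (n + 1))

theorem shiftedProd_eq {a : ℂ} (ha : a ≠ 0) (q : ℂ) (n : ℕ) :
    shiftedProd q a n = qPoch (q ^ 2 / a) (q ^ 2) n * a ^ n := by
  induction n with
  | zero => simp [shiftedProd, qPoch]
  | succ n ih =>
    rw [shiftedProd, Finset.prod_range_succ, ← shiftedProd, ih, qPoch_succ]
    field_simp
    ring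

theorem shiftedProd_zero (q : ℂ) (n : ℕ) : shiftedProd q 0 n = (-1) ^ n * q ^ (n ^ 2 + n) := by
  induction n with
  | zero => simp [shiftedProd]
  | succ n ih =>
    rw [shiftedProd, Finset.prod_range_succ, ← shiftedProd, ih]
    ring

/-- With `a = q^(2m+2)` each factor is `a - q^(2k+2) = -q^(2k+2) (1 - q^(2(m-k)))`, so the product
runs over the top `n` factors of `(q²; q²)_m`. -/
theorem shiftedProd_pow (q : ℂ) {m n : ℕ} (h : n ≤ m) :
    shiftedProd q (q ^ (2 * m + 2)) n * qPoch (q ^ 2) (q ^ 2) (m - n) =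
      (-1) ^ n * q ^ (n ^ 2 + n) * qPoch (q ^ 2) (q ^ 2) m := by
  induction n with
  | zero => simp [shiftedProd]
  | succ n ih =>
    obtain ⟨k, rfl⟩ := Nat.exists_eq_add_of_le h
    have ih := ih (by omega)
    rw [show n + 1 + k - n = k + 1 by omega, qPoch_sq_succ] at ih
    rw [shiftedProd, Finset.prod_range_succ, ← shiftedProd, show n + 1 + k - (n + 1) = k by omega]
    linear_combination (-q ^ (2 * n + 2)) * ih

theorem shiftedProd_pow_eq_zero (q : ℂ) {m n : ℕ} (h : m < n) :
    shiftedProd q (q ^ (2 * m + 2)) n = 0 :=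
  Finset.prod_eq_zero (Finset.mem_range.mpr h) (sub_self _)

theorem norm_shiftedProd_le (q : ℂ) {a : ℂ} {r : ℝ} (ha : ‖a‖ ≤ r) (n : ℕ) :
    ‖shiftedProd q a n‖ ≤ ∏ k ∈ Finset.range n, (r + ‖q‖ ^ (2 * k + 2)) := by
  rw [shiftedProd, norm_prod]
  refine Finset.prod_le_prod (fun _ _ => norm_nonneg _) fun k _ => (norm_sub_le _ _).trans ?_
  rw [norm_pow]
  gcongr

theorem one_sub_mul_norm_pow_pos {q : ℂ} (hq1 : ‖q‖ < 1) {r : ℝ} (hr0 : 0 ≤ r) (hr1 : r < 1)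
    (k : ℕ) : 0 < 1 - r * ‖q‖ ^ k := by
  have : r * ‖q‖ ^ k < 1 := mul_lt_one_of_nonneg_of_lt_one_left hr0 hr1
    (pow_le_one₀ (norm_nonneg q) hq1.le)
  linarith

theorem le_norm_qPoch_sq {q : ℂ} (hq1 : ‖q‖ < 1) {a : ℂ} {r : ℝ} (ha : ‖a‖ ≤ r) (hr1 : r < 1)
    (n : ℕ) : ∏ k ∈ Finset.range n, (1 - r * ‖q‖ ^ (2 * k)) ≤ ‖qPoch a (q ^ 2) n‖ := by
  have hr0 := (norm_nonneg a).trans ha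
  rw [qPoch, norm_prod]
  refine Finset.prod_le_prod (fun k _ => (one_sub_mul_norm_pow_pos hq1 hr0 hr1 _).le) fun k _ => ?_
  have h1 := norm_sub_norm_le 1 (a * (q ^ 2) ^ k)
  rw [norm_one, norm_mul, norm_pow, norm_pow, ← pow_mul] at h1
  have h2 : ‖a‖ * ‖q‖ ^ (2 * k) ≤ r * ‖q‖ ^ (2 * k) := by gcongr
  linarith

/-- A majorant of the terms of the main expansion on the disc of radius `r`. -/
noncomputable def expansionBound (q : ℂ) (r : ℝ) (n : ℕ) : ℝ :=
  2 * (2 * n + 1) * ((∏ k ∈ Finset.range n, (r + ‖q‖ ^ (2 * k + 2))) /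
    ∏ k ∈ Finset.range (n + 1), (1 - r * ‖q‖ ^ (2 * k)))

theorem norm_expansionTerm_le {q : ℂ} (hq : q ≠ 0) (hq1 : ‖q‖ < 1) {a : ℂ} {r : ℝ} (ha : ‖a‖ ≤ r)
    (hr1 : r < 1) (n : ℕ) : ‖expansionTerm q a n‖ ≤ expansionBound q r n := by
  have hr0 := (norm_nonneg a).trans ha
  have h1 : ‖1 + q ^ (2 * n + 1)‖ ≤ 2 := by
    refine (norm_add_le _ _).trans ?_
    rw [norm_one, norm_pow]
    have : ‖q‖ ^ (2 * n + 1) ≤ 1 := pow_le_one₀ (norm_nonneg q) hq1.le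
    linarith
  have h2 : 0 < ∏ k ∈ Finset.range (n + 1), (1 - r * ‖q‖ ^ (2 * k)) :=
    Finset.prod_pos fun k _ => one_sub_mul_norm_pow_pos hq1 hr0 hr1 _
  rw [expansionTerm, norm_mul, norm_mul, norm_div, expansionBound]
  have h3 := norm_bilateralSum_le hq hq1 n
  have h4 := norm_shiftedProd_le q ha n
  have h5 := le_norm_qPoch_sq hq1 ha hr1 (n + 1)
  gcongr

theorem summable_expansionBound {q : ℂ} (hq1 : ‖q‖ < 1) {r : ℝ} (hr0 : 0 < r) (hr1 : r < 1) :
    Summable (expansionBound q r) := by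
  have hpos : ∀ n, 0 < expansionBound q r n := fun n => by
    have h2 : 0 < ∏ k ∈ Finset.range (n + 1), (1 - r * ‖q‖ ^ (2 * k)) :=
      Finset.prod_pos fun k _ => one_sub_mul_norm_pow_pos hq1 hr0.le hr1 _
    have h3 : 0 < ∏ k ∈ Finset.range n, (r + ‖q‖ ^ (2 * k + 2)) :=
      Finset.prod_pos fun k _ => by positivity
    rw [expansionBound]
    positivity
  -- The ratio of consecutive bounds tends to `r`: the linear factor gives `(2n+3)/(2n+1)`, and the
  -- new factors of the two products tend to `r` and `1`.
  refine summable_of_ratio_test_tendsto_lt_one hr1 (.of_forall fun n => (hpos n).ne') ?_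
  have hratio : ∀ n : ℕ, ‖expansionBound q r (n + 1)‖ / ‖expansionBound q r n‖ =
      (1 + 2 * (1 / (2 * (n : ℝ) + 1))) *
        ((r + ‖q‖ ^ (2 * n + 2)) / (1 - r * ‖q‖ ^ (2 * n + 2))) := by
    intro n
    have h2 : 0 < ∏ k ∈ Finset.range (n + 1), (1 - r * ‖q‖ ^ (2 * k)) :=
      Finset.prod_pos fun k _ => one_sub_mul_norm_pow_pos hq1 hr0.le hr1 _
    have h3 : 0 < ∏ k ∈ Finset.range n, (r + ‖q‖ ^ (2 * k + 2)) :=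
      Finset.prod_pos fun k _ => by positivity
    have h4 := one_sub_mul_norm_pow_pos hq1 hr0.le hr1 (2 * n + 2)
    rw [Real.norm_of_nonneg (hpos _).le, Real.norm_of_nonneg (hpos _).le, expansionBound,
      expansionBound, Finset.prod_range_succ _ (n + 1), Finset.prod_range_succ _ n,
      show 2 * (n + 1) = 2 * n + 2 by ring]
    generalize ∏ k ∈ Finset.range (n + 1), (1 - r * ‖q‖ ^ (2 * k)) = A at *
    generalize ∏ k ∈ Finset.range n, (r + ‖q‖ ^ (2 * k + 2)) = B at *
    generalize ‖q‖ ^ (2 * n + 2) = x at *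
    push_cast
    field_simp
    ring
  simp only [hratio]
  have hlin : Tendsto (fun n : ℕ => 2 * n + 2) atTop atTop :=
    tendsto_atTop_mono (fun n => by omega : ∀ n : ℕ, n ≤ 2 * n + 2) tendsto_id
  have hpow : Tendsto (fun n : ℕ => ‖q‖ ^ (2 * n + 2)) atTop (𝓝 0) :=
    (tendsto_pow_atTop_nhds_zero_of_lt_one (norm_nonneg q) hq1).comp hlin
  have hinv : Tendsto (fun n : ℕ => 1 / (2 * (n : ℝ) + 1)) atTop (𝓝 0) := by
    refine (tendsto_const_nhds (x := (1 : ℝ))).div_atTop ?_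
    exact tendsto_atTop_mono (fun n => by linarith [(Nat.cast_nonneg n : (0 : ℝ) ≤ n)])
      (tendsto_natCast_atTop_atTop (R := ℝ))
  have h := ((hinv.const_mul 2).const_add 1).mul
    ((hpow.const_add r).div ((hpow.const_mul r).const_sub 1) (by norm_num))
  simpa using h

theorem differentiableOn_expansionTerm {q : ℂ} (hq1 : ‖q‖ < 1) {r : ℝ} (hr1 : r < 1) (n : ℕ) :
    DifferentiableOn ℂ (fun a => expansionTerm q a n) (Metric.ball 0 r) := by
  have h1 : DifferentiableOn ℂ (fun a => shiftedProd q a n) (Metric.ball 0 r) := by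
    unfold shiftedProd
    fun_prop
  have h2 : DifferentiableOn ℂ (fun a => qPoch a (q ^ 2) (n + 1)) (Metric.ball 0 r) := by
    unfold qPoch
    fun_prop
  exact (h1.div h2 fun a ha => qPoch_ne_zero ((mem_ball_zero_iff.mp ha).trans hr1)
    (norm_sq_lt_one hq1) _).const_mul _

/-- The product side of the main expansion. -/
noncomputable def expansionProd (q a : ℂ) : ℂ :=
  qPochInf (q ^ 2) (q ^ 2) ^ 2 * qPochInf (a * q) (q ^ 2) /
    (qPochInf a (q ^ 2) ^ 2 * qPochInf q (q ^ 2))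

theorem differentiableOn_expansionProd {q : ℂ} (hq1 : ‖q‖ < 1) {r : ℝ} (hr1 : r < 1) :
    DifferentiableOn ℂ (expansionProd q) (Metric.ball 0 r) := by
  have hp := norm_sq_lt_one hq1
  have h1 := differentiableOn_qPochInf hp r
  have h2 : DifferentiableOn ℂ (fun a => qPochInf (a * q) (q ^ 2)) (Metric.ball 0 r) := by
    refine h1.comp (f := fun a => a * q) (by fun_prop) fun a ha => ?_
    rw [mem_ball_zero_iff] at ha ⊢
    rw [norm_mul]
    exact (mul_le_of_le_one_right (norm_nonneg a) hq1.le).trans_lt ha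
  refine DifferentiableOn.div (h2.const_mul _) ((h1.fun_pow 2).mul_const _) fun a ha => ?_
  exact mul_ne_zero (pow_ne_zero 2 (qPochInf_ne_zero ((mem_ball_zero_iff.mp ha).trans hr1) hp))
    (qPochInf_ne_zero hq1 hp)

/-! ### Agreement at `a = q^(2m+2)` and the identity theorem -/

theorem expansionProd_pow {q : ℂ} (hq1 : ‖q‖ < 1) (m : ℕ) :
    expansionProd q (q ^ (2 * m + 2)) =
      qPoch (q ^ 2) (q ^ 2) m ^ 2 / qPoch q (q ^ 2) (m + 1) := by
  have hp := norm_sq_lt_one hq1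
  have h1 := qPoch_mul_qPochInf (q ^ 2) hp m
  have h2 := qPoch_mul_qPochInf q hp (m + 1)
  have h3 := qPochInf_ne_zero hp hp
  have h4 := qPochInf_ne_zero hq1 hp
  rw [show q ^ 2 * (q ^ 2) ^ m = q ^ (2 * m + 2) by ring] at h1
  rw [show q * (q ^ 2) ^ (m + 1) = q ^ (2 * m + 2) * q by ring] at h2
  rw [← h1] at h3
  rw [← h2] at h4
  rw [expansionProd, ← h1, ← h2]
  have h5 := left_ne_zero_of_mul h3
  have h6 := right_ne_zero_of_mul h3
  have h7 := left_ne_zero_of_mul h4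
  have h8 := right_ne_zero_of_mul h4
  generalize qPochInf (q ^ (2 * m + 2) * q) (q ^ 2) = X at *
  field_simp

theorem qPoch_sq_add (q : ℂ) (m n : ℕ) :
    qPoch (q ^ 2) (q ^ 2) m * qPoch (q ^ (2 * m + 2)) (q ^ 2) n =
      qPoch (q ^ 2) (q ^ 2) (m + n) := by
  rw [qPoch, qPoch, qPoch, Finset.prod_range_add]
  congr 1
  refine Finset.prod_congr rfl fun k _ => ?_
  ring

/-- The factor with index `k = m` kills all terms with `n > m`; the remaining finite sum is `(q²;
q²)_m²` times that of `sum_baileyPair`. -/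
theorem tsum_expansionTerm_pow {q : ℂ} (hq : q ≠ 0) (hq1 : ‖q‖ < 1) (m : ℕ) :
    ∑' n, expansionTerm q (q ^ (2 * m + 2)) n = expansionProd q (q ^ (2 * m + 2)) := by
  have hp := norm_sq_lt_one hq1
  have hQ : ∀ n, qPoch (q ^ 2) (q ^ 2) n ≠ 0 := qPoch_ne_zero hp hp
  rw [tsum_eq_sum (s := Finset.range (m + 1)), expansionProd_pow hq1, div_eq_mul_one_div,
    ← sum_baileyPair hq hq1, Finset.mul_sum]
  · refine Finset.sum_congr rfl fun n hn => ?_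
    have h1 := shiftedProd_pow q (Finset.mem_range_succ_iff.mp hn)
    have h2 := qPoch_sq_add q m (n + 1)
    have h3 : qPoch (q ^ (2 * m + 2)) (q ^ 2) (n + 1) ≠ 0 :=
      right_ne_zero_of_mul (h2 ▸ hQ _)
    rw [expansionTerm, show m + n + 1 = m + (n + 1) by ring, ← h2]
    have h4 := hQ m
    have h5 := hQ (m - n)
    rw [eq_div_of_mul_eq h5 h1]
    field_simp
  · intro n hn
    rw [expansionTerm, shiftedProd_pow_eq_zero q (by simpa using hn)]
    simp

theorem hasSum_expansionTerm {q : ℂ} (hq : q ≠ 0) (hq1 : ‖q‖ < 1) {a : ℂ} (ha : ‖a‖ < 1) :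
    HasSum (expansionTerm q a) (expansionProd q a) := by
  obtain ⟨r, har, hr1⟩ := exists_between ha
  have hr0 : 0 < r := (norm_nonneg a).trans_lt har
  have hs := summable_expansionBound hq1 hr0 hr1
  have hle : ∀ n, ∀ w ∈ Metric.ball (0 : ℂ) r, ‖expansionTerm q w n‖ ≤ expansionBound q r n :=
    fun n w hw => norm_expansionTerm_le hq hq1 (mem_ball_zero_iff.mp hw).le hr1 n
  have hF := (Complex.differentiableOn_tsum_of_summable_norm hs
    (differentiableOn_expansionTerm hq1 hr1) Metric.isOpen_ball hle).analyticOnNhd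
    Metric.isOpen_ball
  have hG := (differentiableOn_expansionProd hq1 hr1).analyticOnNhd Metric.isOpen_ball
  have hlin : Tendsto (fun m : ℕ => 2 * m + 2) atTop atTop :=
    tendsto_atTop_mono (fun n => by omega : ∀ n : ℕ, n ≤ 2 * n + 2) tendsto_id
  -- The points of agreement approach the centre of the disc without reaching it, as the identity
  -- theorem requires.
  have hlim : Tendsto (fun m : ℕ => q ^ (2 * m + 2)) atTop (𝓝[≠] 0) :=
    tendsto_nhdsWithin_iff.mpr ⟨(tendsto_pow_atTop_nhds_zero_of_norm_lt_one hq1).comp hlin,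
      .of_forall fun m => pow_ne_zero _ hq⟩
  have hEq := hF.eqOn_of_preconnected_of_frequently_eq hG
    (convex_ball (0 : ℂ) r).isPreconnected (Metric.mem_ball_self hr0)
    (hlim.frequently (Frequently.of_forall fun m => tsum_expansionTerm_pow hq hq1 m))
  have har' : a ∈ Metric.ball (0 : ℂ) r := mem_ball_zero_iff.mpr har
  have hsum : Summable (expansionTerm q a) := .of_norm_bounded hs fun n => hle n a har'
  exact hEq har' ▸ hsum.hasSum

/-! ### Gauss' product formula for `ψ` -/

/-- The finite product `∏_{k=1}^n (1-q^{2k})/(1-q^{2k-1})`. -/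
noncomputable def gaussProd (q : ℝ) (n : ℕ) : ℝ :=
  ∏ k ∈ Finset.range n, (1 - q ^ (2 * k + 2)) / (1 - q ^ (2 * k + 1))

theorem gaussProd_succ (q : ℝ) (n : ℕ) :
    gaussProd q (n + 1) = gaussProd q n * ((1 - q ^ (2 * n + 2)) / (1 - q ^ (2 * n + 1))) :=
  Finset.prod_range_succ _ _

theorem one_sub_pow_succ_pos {q : ℝ} (h0 : 0 < q) (h1 : q < 1) (n : ℕ) : 0 < 1 - q ^ (n + 1) :=
  sub_pos.mpr (pow_lt_one₀ h0.le h1 (Nat.succ_ne_zero n))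

theorem one_le_gaussProd {q : ℝ} (h0 : 0 < q) (h1 : q < 1) (n : ℕ) : 1 ≤ gaussProd q n := by
  induction n with
  | zero => simp [gaussProd]
  | succ n ih =>
    rw [gaussProd_succ]
    refine one_le_mul_of_one_le_of_one_le ih ?_
    rw [one_le_div (one_sub_pow_succ_pos h0 h1 _)]
    have : q ^ (2 * n + 2) ≤ q ^ (2 * n + 1) := pow_le_pow_of_le_one h0.le h1.le (by omega)
    linarith

/-- Partial sums of the difference of consecutive cases of Shanks' identity. -/
theorem sum_range_shanks_sub {q : ℝ} (h0 : 0 < q) (h1 : q < 1) (n N : ℕ) :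
    ∑ s ∈ Finset.range (N + 1), (gaussProd q (n + 1) / gaussProd q s * q ^ (s * (2 * n + 3)) -
        gaussProd q n / gaussProd q s * q ^ (s * (2 * n + 1))) =
      gaussProd q n / gaussProd q N * (1 - q ^ (2 * N + 1)) * q ^ ((N + 1) * (2 * n + 1)) /
        (1 - q ^ (2 * n + 1)) := by
  have hP : ∀ n, gaussProd q n ≠ 0 := fun n => (one_pos.trans_le (one_le_gaussProd h0 h1 n)).ne'
  have h := fun n => (one_sub_pow_succ_pos h0 h1 n).ne'
  have b1 := h (2 * n)
  induction N with
  | zero =>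
    have b2 := hP 0
    rw [Finset.sum_range_one, gaussProd_succ]
    field_simp
    ring
  | succ N ih =>
    have b2 := hP N
    have b3 := h (2 * N)
    have b4 := h (2 * N + 1)
    rw [Finset.sum_range_succ, ih, gaussProd_succ, gaussProd_succ]
    field_simp
    ring

/-- **Shanks' identity**, a finite form of Gauss' product formula for `ψ`. -/
theorem sum_range_pow_triangular {q : ℝ} (h0 : 0 < q) (h1 : q < 1) (n : ℕ) :
    ∑ s ∈ Finset.range (2 * n), q ^ (s * (s + 1) / 2) =
      ∑ s ∈ Finset.range n, gaussProd q n / gaussProd q s * q ^ (s * (2 * n + 1)) := by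
  have hP : ∀ n, gaussProd q n ≠ 0 := fun n => (one_pos.trans_le (one_le_gaussProd h0 h1 n)).ne'
  have h := fun n => (one_sub_pow_succ_pos h0 h1 n).ne'
  induction n with
  | zero => simp
  | succ n ih =>
    rw [show 2 * (n + 1) = 2 * n + 1 + 1 by ring, Finset.sum_range_succ, Finset.sum_range_succ, ih,
      show 2 * n * (2 * n + 1) / 2 = n * (2 * n + 1) by
        rw [mul_assoc, Nat.mul_div_cancel_left _ two_pos],
      show (2 * n + 1) * (2 * n + 1 + 1) / 2 = (2 * n + 1) * (n + 1) by
        rw [show (2 * n + 1) * (2 * n + 1 + 1) = 2 * ((2 * n + 1) * (n + 1)) by ring,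
          Nat.mul_div_cancel_left _ two_pos]]
    have b1 := h (2 * n)
    have b2 := hP n
    -- At `N = n` the closed form reduces to `q^((n+1)(2n+1))`. The term `s = n` missing from the
    -- sum for `n` is `q^(n(2n+1))`. These are the two new triangular powers.
    have key := sum_range_shanks_sub h0 h1 n n
    rw [Finset.sum_sub_distrib, Finset.sum_range_succ (fun s => gaussProd q n / _ * _),
      div_self b2, one_mul, one_mul, mul_div_assoc, mul_comm (1 - _), div_mul_cancel₀ _ b1,
      sub_eq_iff_eq_add] at key
    rw [show 2 * n + 1 + 1 + 1 = 2 * n + 3 by ring, key]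
    ring

/-- A squeeze: the `s = 0` term of Shanks' sum is `gaussProd q n` itself, and `gaussProd q s ≥ 1`
bounds the whole sum by a geometric series, giving `gaussProd q n / (1 - q^(2n+1))`. -/
theorem tendsto_gaussProd {q : ℝ} (h0 : 0 < q) (h1 : q < 1) :
    Tendsto (gaussProd q) atTop (𝓝 (ramanujanPsi q)) := by
  have hP := one_le_gaussProd h0 h1
  have hS := (summable_ramanujanPsi q h0 h1).hasSum.tendsto_sum_nat.comp
    (tendsto_id.const_mul_atTop' two_pos)
  have hlin : Tendsto (fun n : ℕ => 2 * n + 1) atTop atTop :=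
    tendsto_atTop_mono (fun n => by omega : ∀ n : ℕ, n ≤ 2 * n + 1) tendsto_id
  have hpow := (tendsto_pow_atTop_nhds_zero_of_lt_one h0.le h1).comp hlin
  have hlow := hS.mul (hpow.const_sub 1)
  rw [sub_zero, mul_one] at hlow
  refine tendsto_of_tendsto_of_tendsto_of_le_of_le' hlow hS (.of_forall fun n => ?_) ?_
  · simp only [Function.comp_apply, id_eq]
    rw [sum_range_pow_triangular h0 h1, ← le_div_iff₀ (one_sub_pow_succ_pos h0 h1 _)]
    have hpos : 0 < gaussProd q n := one_pos.trans_le (hP n)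
    have hy1 : q ^ (2 * n + 1) < 1 := pow_lt_one₀ h0.le h1 (by omega)
    calc ∑ s ∈ Finset.range n, gaussProd q n / gaussProd q s * q ^ (s * (2 * n + 1))
        ≤ ∑ s ∈ Finset.range n, gaussProd q n * (q ^ (2 * n + 1)) ^ s := by
          refine Finset.sum_le_sum fun s _ => ?_
          rw [← pow_mul, mul_comm (2 * n + 1)]
          gcongr
          exact div_le_self hpos.le (hP s)
      _ = gaussProd q n * ∑ s ∈ Finset.range n, (q ^ (2 * n + 1)) ^ s := by rw [Finset.mul_sum]
      _ ≤ gaussProd q n * (1 - q ^ (2 * n + 1))⁻¹ := by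
          gcongr
          rw [← tsum_geometric_of_lt_one (by positivity) hy1]
          exact (summable_geometric_of_lt_one (by positivity) hy1).sum_le_tsum _
            fun _ _ => by positivity
      _ = gaussProd q n / (1 - q ^ (2 * n + 1)) := rfl
  · filter_upwards [eventually_gt_atTop 0] with n hn
    simp only [Function.comp_apply, id_eq]
    rw [sum_range_pow_triangular h0 h1]
    refine le_trans (le_of_eq ?_) (Finset.single_le_sum (fun s _ => ?_) (Finset.mem_range.mpr hn))
    · simp [gaussProd]
    · have h2 : 0 < gaussProd q n := one_pos.trans_le (hP n)
      have h3 : 0 < gaussProd q s := one_pos.trans_le (hP s)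
      positivity

theorem tendsto_qPoch (a : ℂ) {q : ℂ} (hq1 : ‖q‖ < 1) :
    Tendsto (qPoch a q) atTop (𝓝 (qPochInf a q)) :=
  (multipliable_qPochInf a q hq1).hasProd.tendsto_prod_nat

/-- **Gauss' product formula** for `ψ`. -/
theorem ofReal_ramanujanPsi {q : ℝ} (h0 : 0 < q) (h1 : q < 1) :
    ((ramanujanPsi q : ℝ) : ℂ) =
      qPochInf ((q : ℂ) ^ 2) ((q : ℂ) ^ 2) / qPochInf (q : ℂ) ((q : ℂ) ^ 2) := by
  have hq1 : ‖(q : ℂ)‖ < 1 := by rwa [Complex.norm_of_nonneg h0.le]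
  have hp := norm_sq_lt_one hq1
  refine tendsto_nhds_unique ((Complex.continuous_ofReal.tendsto _).comp (tendsto_gaussProd h0 h1))
    (((tendsto_qPoch _ hp).div (tendsto_qPoch _ hp) (qPochInf_ne_zero hq1 hp)).congr fun n => ?_)
  simp only [Pi.div_apply, Function.comp_apply, gaussProd, qPoch, ← Finset.prod_div_distrib]
  push_cast
  refine Finset.prod_congr rfl fun k _ => ?_
  ring_nf

/-! ### Comparing coefficients of series of monomials -/

/-- A power series with real coefficients vanishing on `(0, 1)` is zero. -/
theorem eq_zero_of_hasSum_pow_eq_zero {c : ℕ → ℝ}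
    (h : ∀ x : ℝ, 0 < x → x < 1 → HasSum (fun n => c n * x ^ n) 0) : c = 0 := by
  by_contra hc
  have hex : ∃ n, c n ≠ 0 := Function.ne_iff.mp hc
  classical
  set N := Nat.find hex with hN
  have hNc : c N ≠ 0 := Nat.find_spec hex
  have hlt : ∀ n < N, c n = 0 := fun n hn => not_not.mp (Nat.find_min hex hn)
  have hsh : ∀ x : ℝ, 0 < x → x < 1 → HasSum (fun n => c (n + N) * x ^ n) 0 := by
    intro x h0 h1
    have hx := (hasSum_nat_add_iff' N).mpr (h x h0 h1)
    rw [Finset.sum_eq_zero fun n hn => by rw [hlt n (Finset.mem_range.mp hn), zero_mul],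
      sub_zero] at hx
    have hx2 := hx.mul_left ((x ^ N)⁻¹)
    rw [mul_zero] at hx2
    refine hx2.congr_fun fun n => ?_
    have : x ^ N ≠ 0 := by positivity
    rw [pow_add]
    field_simp
  have hs := (hsh (1 / 2) (by norm_num) (by norm_num)).summable.norm
  -- After division by `x^N`, let `x → 0` along powers of `1/2`, dominated by the series at `x =
  -- 1/2`; the limit is the first nonzero coefficient.
  have hlim : Tendsto (fun k : ℕ => ∑' n, c (n + N) * ((1 / 2 : ℝ) ^ (k + 1)) ^ n) atTop
      (𝓝 (∑' n, c (n + N) * (0 : ℝ) ^ n)) := by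
    refine tendsto_tsum_of_dominated_convergence hs (fun n => ?_) (.of_forall fun k n => ?_)
    · refine Tendsto.const_mul _ (Tendsto.pow ?_ n)
      exact (tendsto_pow_atTop_nhds_zero_of_lt_one (by norm_num) (by norm_num)).comp
        (tendsto_add_atTop_nat 1)
    · have hk : ((1 / 2 : ℝ) ^ (k + 1)) ≤ 1 / 2 :=
        pow_le_of_le_one (by norm_num) (by norm_num) (Nat.succ_ne_zero k)
      rw [norm_mul, norm_mul, Real.norm_of_nonneg (by positivity : 0 ≤ ((1 / 2 : ℝ) ^ (k + 1)) ^ n),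
        Real.norm_of_nonneg (by positivity : 0 ≤ (1 / 2 : ℝ) ^ n)]
      gcongr
  have hz : ∀ k : ℕ, ∑' n, c (n + N) * ((1 / 2 : ℝ) ^ (k + 1)) ^ n = 0 := fun k =>
    (hsh _ (by positivity) (pow_lt_one₀ (by norm_num) (by norm_num) (Nat.succ_ne_zero k))).tsum_eq
  simp only [hz] at hlim
  have h0 : ∑' n, c (n + N) * (0 : ℝ) ^ n = c N := by
    rw [tsum_eq_single 0 fun n hn => by rw [zero_pow hn, mul_zero]]
    simp
  exact hNc (h0 ▸ (tendsto_nhds_unique hlim tendsto_const_nhds))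

theorem hasSum_card_fiber_mul_pow {ι : Type*} (e : ι → ℕ) {x s : ℝ}
    (h : HasSum (fun i => x ^ e i) s) :
    HasSum (fun n => (Nat.card {i // e i = n} : ℝ) * x ^ n) s := by
  have h1 := (Equiv.sigmaFiberEquiv e).hasSum_iff.mpr h
  refine h1.sigma fun n => ?_
  have h2 := h1.summable.sigma_factor n
  have h3 : (fun i : {i // e i = n} => ((fun i => x ^ e i) ∘ Equiv.sigmaFiberEquiv e) ⟨n, i⟩) =
      fun _ => x ^ n := by
    funext i
    simp [Equiv.sigmaFiberEquiv, i.2]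
  rw [h3] at h2 ⊢
  have h4 := h2.hasSum
  rwa [tsum_const, nsmul_eq_mul] at h4

/-- This excludes the default value `0` of `Nat.card` on infinite types, so a nonempty fibre has a
positive count. -/
theorem finite_fiber_of_summable_pow {ι : Type*} (e : ι → ℕ) {x : ℝ} (hx : 0 < x)
    (h : Summable (fun i => x ^ e i)) (n : ℕ) : Finite {i // e i = n} := by
  have h2 : Summable fun _ : {i // e i = n} => x ^ n :=
    (h.comp_injective (Subtype.val_injective (p := fun i => e i = n))).congr fun i =>
      congrArg (x ^ ·) i.2
  by_contra hf
  rw [not_finite_iff_infinite] at hf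
  exact (pow_pos hx n).ne' ((summable_const_iff _).mp h2)

/-- Two generating functions of exponent families which agree on `(0, 1)` have the same exponents. -/
theorem mem_range_of_hasSum_pow {ι κ : Type*} {e : ι → ℕ} {f : κ → ℕ} {s : ℝ → ℝ}
    (he : ∀ x : ℝ, 0 < x → x < 1 → HasSum (fun i => x ^ e i) (s x))
    (hf : ∀ x : ℝ, 0 < x → x < 1 → HasSum (fun k => x ^ f k) (s x))
    (k : κ) : ∃ i, e i = f k := by
  have h := eq_zero_of_hasSum_pow_eq_zero
    (c := fun n => (Nat.card {i // e i = n} : ℝ) - Nat.card {k // f k = n}) fun x h0 h1 => by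
      have := (hasSum_card_fiber_mul_pow e (he x h0 h1)).sub
        (hasSum_card_fiber_mul_pow f (hf x h0 h1))
      simpa only [sub_self, sub_mul] using this
  have hk := congrFun h (f k)
  simp only [Pi.zero_apply, sub_eq_zero, Nat.cast_inj] at hk
  have := finite_fiber_of_summable_pow f (x := 1 / 2) (by norm_num)
    (hf _ (by norm_num) (by norm_num)).summable (f k)
  have : Nonempty {k' // f k' = f k} := ⟨⟨k, rfl⟩⟩
  have hpos : 0 < Nat.card {i // e i = f k} := hk ▸ Nat.card_pos
  obtain ⟨⟨i, hi⟩⟩ := (Nat.card_pos_iff.mp hpos).1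
  exact ⟨i, hi⟩

theorem hasSum_ramanujanPsi_pow_three {x : ℝ} (h0 : 0 < x) (h1 : x < 1) :
    HasSum (fun i : ℕ × ℕ × ℕ =>
      x ^ (i.1 * (i.1 + 1) / 2 + i.2.1 * (i.2.1 + 1) / 2 + i.2.2 * (i.2.2 + 1) / 2))
      (ramanujanPsi x ^ 3) := by
  have h := summable_ramanujanPsi x h0 h1
  have hn : ∀ n : ℕ, 0 ≤ x ^ (n * (n + 1) / 2) := fun n => by positivity
  have hs2 := h.mul_of_nonneg h hn hn
  have h2 := h.hasSum.mul h.hasSum hs2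
  have hs3 := h.mul_of_nonneg hs2 hn fun i => mul_nonneg (hn _) (hn _)
  have h3 := h.hasSum.mul h2 hs3
  rw [show ramanujanPsi x ^ 3 = ramanujanPsi x * (ramanujanPsi x * ramanujanPsi x) by ring]
  refine h3.congr_fun fun i => ?_
  rw [pow_add, pow_add, mul_assoc]

/-! ### The cases of the expansion -/

theorem hasSum_bilateral {q : ℂ} (hq : q ≠ 0) (hq1 : ‖q‖ < 1) {a : ℂ} (ha0 : a ≠ 0)
    (ha : ‖a‖ < 1) :
    HasSum
      (fun n : ℕ => ∑ j ∈ Finset.Icc (-(n : ℤ)) (n : ℤ),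
        (1 + q ^ (2 * n + 1)) * q ^ (2 * (n : ℤ) ^ 2 + (n : ℤ) - 2 * j ^ 2 - j) *
          (qPoch (q ^ 2 / a) (q ^ 2) n * a ^ n / qPoch a (q ^ 2) (n + 1)))
      (qPochInf (q ^ 2) (q ^ 2) ^ 2 * qPochInf (a * q) (q ^ 2) /
        (qPochInf a (q ^ 2) ^ 2 * qPochInf q (q ^ 2))) := by
  refine (hasSum_expansionTerm hq hq1 ha).congr_fun fun n => ?_
  rw [expansionTerm, bilateralSum, shiftedProd_eq ha0, Finset.mul_sum, Finset.sum_mul]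

theorem hasSum_bilateral_zero {q : ℂ} (hq : q ≠ 0) (hq1 : ‖q‖ < 1) :
    HasSum
      (fun n : ℕ => ∑ j ∈ Finset.Icc (-(n : ℤ)) (n : ℤ),
        (-1 : ℂ) ^ n * (1 + q ^ (2 * n + 1)) *
          q ^ (3 * (n : ℤ) ^ 2 + 2 * (n : ℤ) - 2 * j ^ 2 - j))
      (qPochInf (q ^ 2) (q ^ 2) ^ 2 / qPochInf q (q ^ 2)) := by
  have h := hasSum_expansionTerm hq hq1 (a := 0) (by simp)
  have h0 : ∀ p : ℂ, qPochInf 0 p = 1 := fun p => by simp [qPochInf]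
  have h0' : ∀ (p : ℂ) (n : ℕ), qPoch 0 p n = 1 := fun p n => by simp [qPoch]
  simp only [expansionProd, zero_mul, h0, one_pow, mul_one, one_mul] at h
  refine h.congr_fun fun n => ?_
  rw [expansionTerm, bilateralSum, shiftedProd_zero, h0', div_one, Finset.mul_sum, Finset.sum_mul]
  refine Finset.sum_congr rfl fun j _ => ?_
  rw [show 3 * (n : ℤ) ^ 2 + 2 * (n : ℤ) - 2 * j ^ 2 - j =
    (2 * (n : ℤ) ^ 2 + (n : ℤ) - 2 * j ^ 2 - j) + ((n ^ 2 + n : ℕ) : ℤ) by push_cast; ring,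
    zpow_add₀ hq, zpow_natCast]
  ring

/-- Since `q - q^(2k+2) = q (1 - q^(2k+1))`, only the last factor of the denominator survives. -/
theorem shiftedProd_self_div {q : ℂ} (hq1 : ‖q‖ < 1) (n : ℕ) :
    shiftedProd q q n / qPoch q (q ^ 2) (n + 1) = q ^ n / (1 - q ^ (2 * n + 1)) := by
  have h1 : shiftedProd q q n = qPoch q (q ^ 2) n * q ^ n := by
    rw [shiftedProd, qPoch, ← Finset.card_range n, ← Finset.prod_const, Finset.card_range,
      ← Finset.prod_mul_distrib]
    refine Finset.prod_congr rfl fun k _ => ?_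
    ring
  have h2 := qPoch_ne_zero hq1 (norm_sq_lt_one hq1) n
  have h3 := one_sub_pow_ne_zero hq1 (2 * n)
  rw [h1, qPoch_succ, show q * (q ^ 2) ^ n = q ^ (2 * n + 1) by ring]
  field_simp

theorem hasSum_ramanujanPsi_pow_three_bilateral {q : ℝ} (h0 : 0 < q) (h1 : q < 1) :
    HasSum
      (fun n : ℕ => ∑ j ∈ Finset.Icc (-(n : ℤ)) (n : ℤ),
        (1 + q ^ (2 * n + 1)) / (1 - q ^ (2 * n + 1)) *
          q ^ (2 * (n : ℤ) ^ 2 + 2 * (n : ℤ) - 2 * j ^ 2 - j))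
      (ramanujanPsi q ^ 3) := by
  have hq : (q : ℂ) ≠ 0 := Complex.ofReal_ne_zero.mpr h0.ne'
  have hq1 : ‖(q : ℂ)‖ < 1 := by rwa [Complex.norm_of_nonneg h0.le]
  have h := hasSum_expansionTerm hq hq1 hq1
  have h2 := qPochInf_ne_zero hq1 (norm_sq_lt_one hq1)
  -- At `a = q` one has `aq = q²`, so the product is the cube of Gauss' quotient.
  have hval : expansionProd (q : ℂ) q = ((ramanujanPsi q ^ 3 : ℝ) : ℂ) := by
    rw [Complex.ofReal_pow, ofReal_ramanujanPsi h0 h1, expansionProd, ← sq]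
    field_simp
  rw [hval] at h
  rw [← Complex.hasSum_ofReal]
  refine h.congr_fun fun n => ?_
  rw [expansionTerm, bilateralSum, shiftedProd_self_div hq1, Finset.mul_sum, Finset.sum_mul]
  push_cast
  refine Finset.sum_congr rfl fun j _ => ?_
  rw [show 2 * (n : ℤ) ^ 2 + 2 * (n : ℤ) - 2 * j ^ 2 - j =
    (2 * (n : ℤ) ^ 2 + (n : ℤ) - 2 * j ^ 2 - j) + (n : ℤ) by ring, zpow_add₀ hq, zpow_natCast]
  ring

/-! ### Three triangular numbers -/

/-- The exponents in the expansion of `ψ³` as a series of monomials. -/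
def bilateralExponent (i : Σ n : ℕ, Finset.Icc (-(n : ℤ)) (n : ℤ) × (Fin 2 × ℕ)) : ℕ :=
  (2 * (i.1 : ℤ) ^ 2 + 2 * (i.1 : ℤ) - 2 * (i.2.1 : ℤ) ^ 2 - (i.2.1 : ℤ)).toNat +
    ((2 * i.1 + 1) * (i.2.2.1 : ℕ) + (2 * i.1 + 1) * i.2.2.2)

/-- With `y = x^(2n+1)`, the factor `(1+y)/(1-y)` is the sum of `y^(b+k)` over `b ∈ {0,1}` and `k ≥
0`. -/
theorem hasSum_pow_bilateralExponent {x : ℝ} (h0 : 0 < x) (h1 : x < 1) :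
    HasSum (fun i => x ^ bilateralExponent i) (ramanujanPsi x ^ 3) := by
  have hinner : ∀ n : ℕ, HasSum (fun i => x ^ bilateralExponent ⟨n, i⟩)
      (∑ j ∈ Finset.Icc (-(n : ℤ)) (n : ℤ), (1 + x ^ (2 * n + 1)) / (1 - x ^ (2 * n + 1)) *
          x ^ (2 * (n : ℤ) ^ 2 + 2 * (n : ℤ) - 2 * j ^ 2 - j)) := by
    intro n
    have hb := hasSum_fintype fun b : Fin 2 => (x ^ (2 * n + 1)) ^ (b : ℕ)
    have hk := hasSum_geometric_of_lt_one (r := x ^ (2 * n + 1)) (by positivity)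
      (pow_lt_one₀ h0.le h1 (by omega))
    have hj := hasSum_fintype fun j : Finset.Icc (-(n : ℤ)) (n : ℤ) =>
      x ^ (2 * (n : ℤ) ^ 2 + 2 * (n : ℤ) - 2 * (j : ℤ) ^ 2 - (j : ℤ))
    have sbk := hb.summable.mul_of_nonneg hk.summable (fun _ => by positivity)
      (fun _ => by positivity)
    have hbk := hb.mul hk sbk
    have h := hj.mul hbk (hj.summable.mul_of_nonneg sbk (fun _ => by positivity)
      (fun _ => by positivity))
    rw [Finset.sum_coe_sort (Finset.Icc (-(n : ℤ)) (n : ℤ)) (fun j : ℤ =>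
      x ^ (2 * (n : ℤ) ^ 2 + 2 * (n : ℤ) - 2 * j ^ 2 - j)), Fin.sum_univ_two] at h
    simp only [Fin.val_zero, Fin.val_one, pow_zero, pow_one, ← div_eq_mul_inv] at h
    rw [← Finset.mul_sum, mul_comm]
    refine h.congr_fun fun i => ?_
    -- The exponent is `2(n² - j²) + (2n - j)` with `|j| ≤ n`, so `toNat` loses nothing.
    have hnn : 0 ≤ 2 * (n : ℤ) ^ 2 + 2 * (n : ℤ) - 2 * (i.1 : ℤ) ^ 2 - (i.1 : ℤ) := by
      have := Finset.mem_Icc.mp i.1.2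
      nlinarith
    rw [bilateralExponent, pow_add, pow_add, pow_mul, pow_mul]
    congr 1
    rw [← zpow_natCast, Int.toNat_of_nonneg hnn]
  have ho := hasSum_ramanujanPsi_pow_three_bilateral h0 h1
  refine HasSum.sigma_of_hasSum ho hinner ((summable_sigma_of_nonneg fun _ => by positivity).mpr
    ⟨fun n => (hinner n).summable, ?_⟩)
  simpa only [(hinner _).tsum_eq] using ho.summable

theorem exists_eq_add_triangular (N : ℕ) : ∃ x y z : ℕ,
    N = x * (x + 1) / 2 + y * (y + 1) / 2 + z * (z + 1) / 2 := by
  -- The index `n = j = b = 0`, `k = N` has exponent `N`.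
  obtain ⟨i, hi⟩ := mem_range_of_hasSum_pow (fun x => hasSum_ramanujanPsi_pow_three (x := x))
    (fun x => hasSum_pow_bilateralExponent (x := x)) ⟨0, ⟨0, by simp⟩, 0, N⟩
  exact ⟨i.1, i.2.1, i.2.2, by simpa [bilateralExponent] using hi.symm⟩

/-- `HasSum` here is unconditional, hence absolute, convergence. The case `a = 0` is separate
because `q²/0 = 0` in Lean is not the intended limit. -/
theorem mainTheorem7 :
    (∀ q : ℝ, 0 < q → q < 1 →
      (∀ a : ℂ, a ≠ 0 → ‖a‖ < 1 →
        HasSum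
          (fun n : ℕ => ∑ j ∈ Finset.Icc (-(n : ℤ)) (n : ℤ),
            (1 + (q : ℂ) ^ (2 * n + 1)) *
              (q : ℂ) ^ (2 * (n : ℤ) ^ 2 + (n : ℤ) - 2 * j ^ 2 - j) *
              (qPoch ((q : ℂ) ^ 2 / a) ((q : ℂ) ^ 2) n * a ^ n /
                qPoch a ((q : ℂ) ^ 2) (n + 1)))
          (qPochInf ((q : ℂ) ^ 2) ((q : ℂ) ^ 2) ^ 2 * qPochInf (a * (q : ℂ)) ((q : ℂ) ^ 2) /
            (qPochInf a ((q : ℂ) ^ 2) ^ 2 * qPochInf (q : ℂ) ((q : ℂ) ^ 2)))) ∧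
      HasSum
        (fun n : ℕ => ∑ j ∈ Finset.Icc (-(n : ℤ)) (n : ℤ),
          (-1 : ℂ) ^ n * (1 + (q : ℂ) ^ (2 * n + 1)) *
            (q : ℂ) ^ (3 * (n : ℤ) ^ 2 + 2 * (n : ℤ) - 2 * j ^ 2 - j))
        (qPochInf ((q : ℂ) ^ 2) ((q : ℂ) ^ 2) ^ 2 / qPochInf (q : ℂ) ((q : ℂ) ^ 2)) ∧
      HasSum
        (fun n : ℕ => ∑ j ∈ Finset.Icc (-(n : ℤ)) (n : ℤ),
          (1 + q ^ (2 * n + 1)) / (1 - q ^ (2 * n + 1)) *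
            q ^ (2 * (n : ℤ) ^ 2 + 2 * (n : ℤ) - 2 * j ^ 2 - j))
        (ramanujanPsi q ^ 3)) ∧
    (∀ N : ℕ, ∃ x y z : ℕ,
      N = x * (x + 1) / 2 + y * (y + 1) / 2 + z * (z + 1) / 2) := by
  refine ⟨fun q h0 h1 => ?_, exists_eq_add_triangular⟩
  have hq : (q : ℂ) ≠ 0 := Complex.ofReal_ne_zero.mpr h0.ne'
  have hq1 : ‖(q : ℂ)‖ < 1 := by rwa [Complex.norm_of_nonneg h0.le]
  exact ⟨fun a ha0 ha => hasSum_bilateral hq hq1 ha0 ha, hasSum_bilateral_zero hq hq1,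
    hasSum_ramanujanPsi_pow_three_bilateral h0 h1⟩
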